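/- Let $\Phi$ be an irreducible (reduced, crystallographic) root system with base $\alpha_1,\dots,\alpha_n$, Cartan matrix $a_{ij}=\langle\alpha_j,\alpha_i^\vee\rangle$, root lattice $Q$ and weight lattice $P=\{\lambda\in\mathfrak h^*:\langle\lambda,\alpha^\vee\rangle\in\mathbb Z\ \forall\alpha\in\Phi\}$. Let $d_1,\dots,d_n$ be the relatively prime positive integers for which $(d_ia_{ij})$ is symmetric, and let $(\cdot,\cdot)$ be the bilinear form on $\mathfrak h^*$ with $(\alpha_i,\alpha_j)=d_ia_{ij}$. Let $\theta=\sum_i h_i\alpha_i$ be the highest root and let $\gamma$ be the least common multiple of all prime numbers among the $h_i$ (so $\gamma=1$ if no $h_i$ is prime, that is, in type $A$). Let $q$ be an indeterminate and, for $m\ge 1$, let $\mathbb C(q^{1/m})$ be the subfield of the algebraic closure of $\mathbb C(q)$ generated by $\mathbb C(q)$ and an $m$-th root $q^{1/m}$ of $q$. For a field $\mathbb F$ containing $q$, let $U^0_{\mathbb F}$ be the commutative $\mathbb F$-algebra with basis $K_\mu$ ($\mu\in Q$) and product $K_\mu K_\nu=K_{\mu+\nu}$, let $T_{\mathbb F}=\mathrm{Hom}_{\mathbb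 F\text{-alg}}(U^0_{\mathbb F},\mathbb F)$, and for $\Lambda\in T_{\mathbb F}$ put $$\Phi_\Lambda=\{\alpha\in\Phi:\Lambda(K_{2\alpha})\in q^{\mathbb Z(\alpha,\alpha)}\}.$$ For $\lambda\in\mathfrak h^*$ put $\Phi_\lambda=\{\alpha\in\Phi:\langle\lambda,\alpha^\vee\rangle\in\mathbb Z\}$. A root subsystem of $\Phi$ is a (possibly empty) subset $\Psi$ with $-\alpha\in\Psi$ and $s_\beta\alpha\in\Psi$ for all $\alpha,\beta\in\Psi$; a proper root subsystem is maximal if no root subsystem lies strictly between it and $\Phi$. Call $\Psi^\vee$ closed in $\Phi^\vee$ if $\alpha^\vee+\beta^\vee\in\Psi^\vee$ whenever $\alpha^\vee,\beta^\vee\in\Psi^\vee$ and $\alpha^\vee+\beta^\vee\in\Phi^\vee$. Let $\Psi$ be a maximal root subsystem of $\Phi$. 1. For $\mathbb F=\mathbb C(q^{1/\gamma})$ there is $\Lambda\in T_{\mathbb F}$ with $\Psi=\Phi_\Lambda$. 2. Suppose that $\Psi^\vee$ is closed in $\Phi^\vee$, and let $m\ge 2$ be any multiple of $\gamma$ (so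 one may take $m=\gamma$ unless $\gamma=1$). Then there is $\lambda\in\frac1m P$ with $\Psi=\Phi_\lambda$; moreover the linear weight $q^\lambda\colon K_\mu\mapsto q^{(\lambda,\mu)}=(q^{1/m})^{m(\lambda,\mu)}$ is a well-defined element of $T_{\mathbb C(q^{1/m})}$ and $\Psi=\Phi_{q^\lambda}$. -/

import Mathlib

noncomputable section

namespace QRoot

/-! ### Root subsystems -/

section Subsystems

variable {ι V V' : Type*} [AddCommGroup V] [Module ℂ V] [AddCommGroup V'] [Module ℂ V']

/-- A set `Ψ` of roots (given by their indices) is a root subsystem of `Φ` if it is stable under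
negation and `s_β α ∈ Ψ` whenever `α, β ∈ Ψ`. The empty set is allowed. -/
def IsRootSubsystem (Φ : RootPairing ι ℂ V V') (Ψ : Set ι) : Prop :=
  (∀ i ∈ Ψ, ∀ j, Φ.root j = -Φ.root i → j ∈ Ψ) ∧
  (∀ i ∈ Ψ, ∀ j ∈ Ψ, Φ.reflectionPerm j i ∈ Ψ)

/-- A proper root subsystem `Ψ ⊊ Φ` is maximal if there is no root subsystem strictly between
`Ψ` and `Φ`. -/
def IsMaximalSubsystem (Φ : RootPairing ι ℂ V V') (Ψ : Set ι) : Prop :=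
  IsRootSubsystem Φ Ψ ∧ Ψ ≠ Set.univ ∧
  ¬ ∃ Ψ' : Set ι, IsRootSubsystem Φ Ψ' ∧ Ψ ⊂ Ψ' ∧ Ψ' ⊂ Set.univ

/-- `Ψ` is closed in `Φ`: a root which is a sum of two elements of `Ψ` belongs to `Ψ`. -/
def IsClosedIn (Φ : RootPairing ι ℂ V V') (Ψ : Set ι) : Prop :=
  ∀ i ∈ Ψ, ∀ j ∈ Ψ, ∀ k, Φ.root k = Φ.root i + Φ.root j → k ∈ Ψ

/-- `Ψ^∨` is closed in the dual system `Φ^∨`. -/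
def IsDualClosed (Φ : RootPairing ι ℂ V V') (Ψ : Set ι) : Prop :=
  IsClosedIn Φ.flip Ψ

/-- The weight lattice `P = {λ | ⟨λ, α^∨⟩ ∈ ℤ for all roots α}`. -/
def weightLattice (Φ : RootPairing ι ℂ V V') : Set V :=
  {lam | ∀ i, ∃ n : ℤ, Φ.coroot' i lam = n}

/-- The lattice `(1/m) P`. -/
def fracWeightLattice (Φ : RootPairing ι ℂ V V') (m : ℕ) : Set V :=
  {lam | ∃ mu ∈ weightLattice Φ, lam = ((m : ℂ)⁻¹) • mu}

/-- The integral root subsystem `Φ_λ = {α | ⟨λ, α^∨⟩ ∈ ℤ}` of `λ ∈ 𝔥^*`. -/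
def integralRoots (Φ : RootPairing ι ℂ V V') (lam : V) : Set ι :=
  {i | ∃ n : ℤ, Φ.coroot' i lam = n}

end Subsystems

/-! ### The normalised form, the highest root and the constant `γ` -/

section Base

variable {ι V V' : Type*} [AddCommGroup V] [Module ℂ V] [AddCommGroup V'] [Module ℂ V']
  {Φ : RootPairing ι ℂ V V'}

/-- `(d_i)` are relatively prime positive integers such that `(d_i a_ij)` is symmetric, where
`a_ij = ⟨α_j, α_i^∨⟩` is the Cartan matrix. -/
def IsSymmetrizer (b : Φ.Base) (d : b.support → ℕ) : Prop :=
  (∀ i, 0 < d i) ∧ Finset.univ.gcd d = 1 ∧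
  ∀ i j : b.support, (d i : ℂ) * Φ.pairing j i = (d j : ℂ) * Φ.pairing i j

open Classical in
/-- The bilinear form on `𝔥^*` with `(α_i, α_j) = d_i a_ij` on simple roots. -/
def form [Φ.IsRootSystem] (b : Φ.Base) (d : b.support → ℕ) : LinearMap.BilinForm ℂ V :=
  Matrix.toBilin b.toWeightBasis (Matrix.of fun i j : b.support => (d i : ℂ) * Φ.pairing j i)

/-- `θ` is the highest root: `θ - α ∈ Q⁺` for every root `α`. -/
def IsHighestRoot (b : Φ.Base) (θ : ι) : Prop :=
  ∀ j, Φ.root θ - Φ.root j ∈ AddSubmonoid.closure (Φ.root '' b.support)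

/-- The coefficient of the simple root `α_i` in the expansion of the root `α_k`, up to sign. -/
def absCoeff (b : Φ.Base) (k : ι) (i : b.support) : ℕ :=
  (b.toWeightBasisInt.repr (Φ.rootSpanMem ℤ k) i).natAbs

/-- `γ`: the least common multiple of all prime coefficients `h_i` in `θ = ∑ h_i α_i`
(equal to `1` if no coefficient is prime). -/
def gammaConst (b : Φ.Base) (θ : ι) : ℕ :=
  (Finset.univ.filter fun i => (absCoeff b θ i).Prime).lcm (absCoeff b θ)

end Base

/-! ### Weights of the Cartan part of the quantum group -/

/-- The algebraic closure `𝐤` of `ℂ(q)`. -/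
abbrev K : Type := AlgebraicClosure (RatFunc ℂ)

/-- The indeterminate `q`, as an element of `𝐤`. -/
def qK : K := algebraMap (RatFunc ℂ) K RatFunc.X

/-- The subfield `ℂ(q)(s)` of `𝐤`; it is `ℂ(q^{1/m})` if `s = q^{1/m}`. -/
abbrev adjoinField (s : K) : IntermediateField (RatFunc ℂ) K :=
  IntermediateField.adjoin (RatFunc ℂ) {s}

/-- The indeterminate `q`, as an element of `ℂ(q)(s)`. -/
def qElt (s : K) : adjoinField s := algebraMap (RatFunc ℂ) (adjoinField s) RatFunc.X

section Weights

variable {ι V V' : Type*} [AddCommGroup V] [Module ℂ V] [AddCommGroup V'] [Module ℂ V']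

/-- `U^0_F`, the commutative `F`-algebra generated by `K_μ`, `μ ∈ Q`, with `K_μ K_ν = K_{μ+ν}` and
`K_0 = 1`: the group algebra of the root lattice `Q = ℤΦ`. -/
abbrev CartanAlg (Φ : RootPairing ι ℂ V V') (F : Type*) [Field F] : Type _ :=
  AddMonoidAlgebra F (Φ.rootSpan ℤ)

/-- The element `K_μ` of `U^0_F`. -/
def Kelt (Φ : RootPairing ι ℂ V V') (F : Type*) [Field F] (mu : Φ.rootSpan ℤ) : CartanAlg Φ F :=
  AddMonoidAlgebra.single mu 1

/-- The weights `T_F = Hom_{F-alg}(U^0_F, F)`. -/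
abbrev Weight (Φ : RootPairing ι ℂ V V') (F : Type*) [Field F] : Type _ :=
  CartanAlg Φ F →ₐ[F] F

variable {Φ : RootPairing ι ℂ V V'}

/-- `z = q^x`, where `t = q^{1/m}` and the exponent `x` lies in `(1/m)ℤ`: it says that `m x` is
an integer and that `z = t^{m x}`. -/
def IsQPow {F : Type*} [Field F] (t : F) (m : ℕ) (x : ℂ) (z : F) : Prop :=
  ∃ a : ℤ, (m : ℂ) * x = a ∧ z = t ^ a

/-- `Φ_Λ = {α ∈ Φ | Λ(K_{2α}) ∈ q^{ℤ(α,α)}}`. -/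
def weightRoots [Φ.IsRootSystem] (b : Φ.Base) (d : b.support → ℕ) {F : Type*} [Field F] (q : F)
    (Lam : Weight Φ F) : Set ι :=
  {i | ∃ k : ℤ, IsQPow q 1 ((k : ℂ) * form b d (Φ.root i) (Φ.root i))
    (Lam (Kelt Φ F ((2 : ℤ) • Φ.rootSpanMem ℤ i)))}

/-- `Λ` is the linear weight `q^λ : K_μ ↦ q^{(λ, μ)}`, where `t = q^{1/m}` and `λ ∈ (1/m)P`. -/
def IsLinearWeight [Φ.IsRootSystem] (b : Φ.Base) (d : b.support → ℕ) {F : Type*} [Field F]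
    (t : F) (m : ℕ) (lam : V) (Lam : Weight Φ F) : Prop :=
  ∀ mu : Φ.rootSpan ℤ, IsQPow t m (form b d lam (mu : V)) (Lam (Kelt Φ F mu))

end Weights

end QRoot

end

open Submodule Module

namespace QRoot

/-! A proper sublattice is killed modulo some prime p by an integral functional that is nonzero mod
p (`exists_prime_functional`), and the roots, or coroots, killed mod p form a root subsystem. So if
Ψ spans a proper sublattice of Q, maximality gives Ψ = {α : p ∣ u(α)}, and K_μ ↦ ζ^u(μ), with ζ a
primitive 2p-th root of unity, is the required weight. If Ψ^∨ spans a proper sublattice of Q^∨, then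
likewise Ψ = {α : p ∣ w(α^∨)} = Φ_λ for λ = w/p, and q^λ is the required weight as soon as p ∣ m
(`exists_isLinearWeight`). One of the two cases always occurs, since a subsystem contains every
short root of its span and, dually, every long root whose coroot lies in the span of Ψ^∨
(`IsRootSubsystem.eq_univ_of_span_eq`).

The arithmetic point is that p ∣ γ when Ψ has full rank. After a transfer from coroots to roots
(`exists_isFullRankMod_of_coroot`) this is Borel–de Siebenthal (`IsFullRankMod.exists_absCoeff_eq`):
affine reflections bring a functional into the alcove 0 ≤ α_i, θ ≤ p; full rank makes it a vertex v,
nonzero on a single α_i, so p = v(α_i) h_i; as v is nonzero mod p, h_i = p.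

If Ψ^∨ is closed, it contains every coroot in its span, so w always exists. Either Ψ^∨ fails to span
Q^∨ modulo a prime divisor of m, which then serves as p, or Ψ has full rank and p ∣ γ ∣ m. -/

/-- A proper subgroup of a finitely generated free abelian group is contained in the kernel of the
reduction modulo some prime `p` of an integral functional which does not vanish modulo `p`. -/
lemma exists_prime_functional {M : Type*} [AddCommGroup M] [Module.Finite ℤ M] [Module.Free ℤ M]
    {N : Submodule ℤ M} (hN : N ≠ ⊤) :
    ∃ p : ℕ, p.Prime ∧ ∃ f : M →ₗ[ℤ] ℤ, (∀ x ∈ N, (p : ℤ) ∣ f x) ∧ ∃ x, ¬ (p : ℤ) ∣ f x := by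
  obtain ⟨C, hC, hNC⟩ := (eq_top_or_exists_le_coatom N).resolve_left hN
  have hs : IsSimpleModule ℤ (M ⧸ C) := isSimpleModule_iff_isCoatom.mpr hC
  obtain ⟨I, hI, ⟨e⟩⟩ := isSimpleModule_iff_quot_maximal.mp hs
  -- The quotient by a coatom is ℤ/I with I maximal; freeness of M lifts this quotient map to ℤ.
  obtain ⟨f, hf⟩ := Module.projective_lifting_property (Submodule.mkQ I)
    (e.toLinearMap ∘ₗ C.mkQ) (Submodule.mkQ_surjective I)
  have key (x : M) : f x ∈ I ↔ x ∈ C := by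
    have h := LinearMap.congr_fun hf x
    simp only [LinearMap.comp_apply, LinearEquiv.coe_coe] at h
    rw [← Submodule.Quotient.mk_eq_zero I, ← Submodule.Quotient.mk_eq_zero C]
    constructor
    · intro h0
      apply e.injective
      rw [map_zero, ← h0]
      exact h.symm
    · intro h0
      have : e (C.mkQ x) = 0 := by
        rw [Submodule.mkQ_apply, h0, map_zero]
      exact h.trans this
  obtain ⟨n, rfl⟩ := (IsPrincipalIdealRing.principal I).principal
  have hn0 : n ≠ 0 := by
    rintro rfl
    refine Int.not_isField (Ring.isField_iff_maximal_bot.mpr ?_)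
    simpa using hI
  have hn : Prime n := (Ideal.span_singleton_prime hn0).mp hI.isPrime
  refine ⟨n.natAbs, Int.prime_iff_natAbs_prime.mp hn, f, fun x hx ↦ ?_, ?_⟩
  · rw [Int.natAbs_dvd, ← Ideal.mem_span_singleton]
    exact (key x).mpr (hNC hx)
  · obtain ⟨x, -, hx⟩ := SetLike.exists_of_lt hC.lt_top
    refine ⟨x, ?_⟩
    rw [Int.natAbs_dvd, ← Ideal.mem_span_singleton]
    exact fun h ↦ hx ((key x).mp h)

/-! ### Root subsystems and the lattices they span -/

section Subsystems

variable {ι V V' : Type*} [AddCommGroup V] [Module ℂ V] [AddCommGroup V'] [Module ℂ V']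

lemma IsRootSubsystem.flip {Φ : RootPairing ι ℂ V V'} {Ψ : Set ι} (h : IsRootSubsystem Φ Ψ) :
    IsRootSubsystem Φ.flip Ψ := by
  refine ⟨fun i hi j hj ↦ h.1 i hi j ?_, h.2⟩
  rw [Φ.root_eq_neg_iff]
  exact Φ.coroot_eq_neg_iff.mp hj

lemma IsRootSubsystem.neg_mem {Φ : RootPairing ι ℂ V V'} {Ψ : Set ι} (h : IsRootSubsystem Φ Ψ)
    {i : ι} (hi : i ∈ Ψ) : Φ.reflectionPerm i i ∈ Ψ :=
  h.2 i hi i hi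

lemma IsMaximalSubsystem.eq_of_subset {Φ : RootPairing ι ℂ V V'} {Ψ Ψ' : Set ι}
    (h : IsMaximalSubsystem Φ Ψ) (h' : IsRootSubsystem Φ Ψ') (hsub : Ψ ⊆ Ψ') {i : ι}
    (hi : i ∉ Ψ') : Ψ = Ψ' := by
  by_contra hne
  refine h.2.2 ⟨Ψ', h', hsub.ssubset_of_ne hne, Set.ssubset_univ_iff.mpr ?_⟩
  rintro rfl
  exact hi (Set.mem_univ i)

lemma IsMaximalSubsystem.flip {Φ : RootPairing ι ℂ V V'} {Ψ : Set ι}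
    (h : IsMaximalSubsystem Φ Ψ) : IsMaximalSubsystem Φ.flip Ψ :=
  ⟨h.1.flip, h.2.1, fun ⟨Ψ', h₁, h₂⟩ ↦ h.2.2 ⟨Ψ', h₁.flip, h₂⟩⟩

lemma pairingIn_flip (Φ : RootPairing ι ℂ V V') [Φ.IsCrystallographic] (i j : ι) :
    Φ.flip.pairingIn ℤ i j = Φ.pairingIn ℤ j i := by
  apply FaithfulSMul.algebraMap_injective ℤ ℂ
  simp only [RootPairing.algebraMap_pairingIn, RootPairing.pairing_flip]

lemma coe_pairingIn (Φ : RootPairing ι ℂ V V') [Φ.IsCrystallographic] (i j : ι) :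
    (Φ.pairingIn ℤ i j : ℂ) = Φ.pairing i j := by
  simpa using Φ.algebraMap_pairingIn ℤ i j

lemma rootSpanMem_reflectionPerm (Φ : RootPairing ι ℂ V V') [Φ.IsCrystallographic] (i j : ι) :
    Φ.rootSpanMem ℤ (Φ.reflectionPerm i j) =
      Φ.rootSpanMem ℤ j - Φ.pairingIn ℤ j i • Φ.rootSpanMem ℤ i := by
  ext
  simpa using Φ.reflection_apply_root' ℤ (i := i) (j := j)

/-- The roots on which an integral functional is divisible by `p` form a root subsystem. -/
lemma isRootSubsystem_dvd (Φ : RootPairing ι ℂ V V') [Φ.IsCrystallographic]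
    (u : Φ.rootSpan ℤ →ₗ[ℤ] ℤ) (p : ℤ) :
    IsRootSubsystem Φ {i | p ∣ u (Φ.rootSpanMem ℤ i)} := by
  refine ⟨fun i hi j hj ↦ ?_, fun i hi j hj ↦ ?_⟩
  · have : Φ.rootSpanMem ℤ j = -Φ.rootSpanMem ℤ i := by ext; simpa using hj
    simpa [this] using hi
  · rw [Set.mem_ofPred_eq] at hi hj ⊢
    rw [rootSpanMem_reflectionPerm, map_sub, map_smul, smul_eq_mul]
    exact dvd_sub hi (hj.mul_left _)

/-- Roots generate the lattice, so a functional nonzero mod p is nonzero mod p on some root; the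
right-hand side is thus a proper subsystem, and maximality applies. -/
lemma IsMaximalSubsystem.eq_setOf_dvd {Φ : RootPairing ι ℂ V V'} [Φ.IsCrystallographic]
    {Ψ : Set ι} (h : IsMaximalSubsystem Φ Ψ) {u : Φ.rootSpan ℤ →ₗ[ℤ] ℤ} {p : ℤ}
    (hu : ∀ i ∈ Ψ, p ∣ u (Φ.rootSpanMem ℤ i)) (hne : ∃ x, ¬ p ∣ u x) :
    Ψ = {i | p ∣ u (Φ.rootSpanMem ℤ i)} := by
  obtain ⟨i, hi⟩ : ∃ i, ¬ p ∣ u (Φ.rootSpanMem ℤ i) := by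
    by_contra! hall
    obtain ⟨⟨x, hx⟩, hpx⟩ := hne
    refine hpx ?_
    clear hpx
    induction hx using Submodule.span_induction with
    | mem x hx => obtain ⟨i, rfl⟩ := hx; exact hall i
    | zero => exact (map_zero u).symm ▸ dvd_zero p
    | add x y hx hy ihx ihy => exact (map_add u ⟨x, hx⟩ ⟨y, hy⟩).symm ▸ dvd_add ihx ihy
    | smul a x hx ih => exact (map_smul u a ⟨x, hx⟩).symm ▸ ih.mul_left a
  exact h.eq_of_subset (isRootSubsystem_dvd Φ u p) hu hi

/-- Induction over the roots in the lattice spanned by a root subsystem: each of them is obtained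
from an element of `Ψ` by successively adding elements of `Ψ` at an acute angle to the sum. -/
lemma root_mem_span_induction {Φ : RootPairing ι ℂ V V'} [Finite ι] [Φ.IsCrystallographic]
    {Ψ : Set ι} (hΨ : IsRootSubsystem Φ Ψ) {C : ι → Prop} (mem : ∀ i ∈ Ψ, C i)
    (add : ∀ i j k, j ∈ Ψ → i ≠ j → 0 < Φ.pairingIn ℤ i j → Φ.root k = Φ.root i - Φ.root j → C k →
      C i) {i : ι} (hi : Φ.root i ∈ span ℤ (Φ.root '' Ψ)) : C i := by
  classical
  -- Since Ψ = -Ψ, integral combinations are plain sums, and induction on the number of summands is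
  -- possible.
  have hlist (x : V) (hx : x ∈ span ℤ (Φ.root '' Ψ)) :
      ∃ l : List ι, (∀ j ∈ l, j ∈ Ψ) ∧ (l.map Φ.root).sum = x := by
    induction hx using Submodule.span_induction with
    | mem x hx => obtain ⟨j, hj, rfl⟩ := hx; exact ⟨[j], by simpa using hj, by simp⟩
    | zero => exact ⟨[], by simp, by simp⟩
    | add x y _ _ ihx ihy =>
      obtain ⟨l, hl, rfl⟩ := ihx
      obtain ⟨l', hl', rfl⟩ := ihy
      refine ⟨l ++ l', fun j hj ↦ ?_, by simp⟩
      rcases List.mem_append.mp hj with hj | hj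
      exacts [hl j hj, hl' j hj]
    | smul a x _ ih =>
      obtain ⟨l, hl, rfl⟩ := ih
      have hnat (n : ℕ) : ∃ l' : List ι, (∀ j ∈ l', j ∈ Ψ) ∧
          (l'.map Φ.root).sum = n • (l.map Φ.root).sum := by
        induction n with
        | zero => exact ⟨[], by simp, by simp⟩
        | succ n ih =>
          obtain ⟨l', hl', h'⟩ := ih
          refine ⟨l' ++ l, fun j hj ↦ ?_, by simp [h', succ_nsmul]⟩
          rcases List.mem_append.mp hj with hj | hj
          exacts [hl' j hj, hl j hj]
      have hneg (l : List ι) : ((l.map fun j ↦ Φ.reflectionPerm j j).map Φ.root).sum =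
          -(l.map Φ.root).sum := by
        induction l with
        | nil => simp
        | cons j l ih =>
          simp only [List.map_cons, List.sum_cons, ih]
          simp [add_comm]
      obtain ⟨n, rfl | rfl⟩ := a.eq_nat_or_neg
      · obtain ⟨l', hl', h'⟩ := hnat n
        exact ⟨l', hl', by simpa using h'⟩
      · obtain ⟨l', hl', h'⟩ := hnat n
        refine ⟨l'.map fun j ↦ Φ.reflectionPerm j j, fun j hj ↦ ?_, ?_⟩
        · obtain ⟨k, hk, rfl⟩ := List.mem_map.mp hj
          exact hΨ.neg_mem (hl' k hk)
        · rw [hneg, h', neg_smul, natCast_zsmul]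
  obtain ⟨l, hl, hli⟩ := hlist _ hi
  clear hi
  generalize hn : l.length = n
  induction n generalizing l i with
  | zero =>
    obtain rfl := List.length_eq_zero_iff.mp hn
    exact (Φ.ne_zero i (by simpa using hli.symm)).elim
  | succ n ih =>
    -- The summands' pairings with the coroot of i add up to 2, so one of them is positive.
    obtain ⟨j, hjl, hj⟩ : ∃ j ∈ l, 0 < Φ.pairingIn ℤ j i := by
      by_contra! hcon
      have hsum : ((l.map fun j ↦ Φ.pairingIn ℤ j i).sum : ℤ) = 2 := by
        have h2 : Φ.coroot' i (l.map Φ.root).sum = 2 := by rw [hli]; simp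
        rw [map_list_sum, List.map_map] at h2
        have : ((l.map fun j ↦ Φ.pairingIn ℤ j i).sum : ℂ) = 2 := by
          rw [← h2, Int.cast_list_sum, List.map_map]
          congr 1
          refine List.map_congr_left fun j _ ↦ ?_
          simp [coe_pairingIn]
        exact_mod_cast this
      have : (l.map fun j ↦ Φ.pairingIn ℤ j i).sum ≤ 0 := by
        simpa using List.sum_le_sum (f := fun j ↦ Φ.pairingIn ℤ j i) (g := fun _ ↦ 0) hcon
      lia
    rcases eq_or_ne i j with rfl | hij
    · exact mem i (hl i hjl)
    rw [Φ.zero_lt_pairingIn_iff'] at hj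
    obtain ⟨k, hk⟩ := Φ.root_sub_root_mem_of_pairingIn_pos hj hij
    refine add i j k (hl j hjl) hij hj hk (ih (l.erase j) (fun a ha ↦ hl a (List.mem_of_mem_erase ha))
      ?_ ?_)
    · rw [hk, ← hli, ((List.perm_cons_erase hjl).map Φ.root).sum_eq]
      simp
    · rw [List.length_erase_of_mem hjl, hn, Nat.add_sub_cancel]

lemma IsClosedIn.mem_of_root_mem_span {Φ : RootPairing ι ℂ V V'} [Finite ι] [Φ.IsCrystallographic]
    {Ψ : Set ι} (hΨ : IsRootSubsystem Φ Ψ) (hcl : IsClosedIn Φ Ψ) {i : ι}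
    (hi : Φ.root i ∈ span ℤ (Φ.root '' Ψ)) : i ∈ Ψ :=
  root_mem_span_induction hΨ (C := (· ∈ Ψ)) (fun _ ↦ id)
    (fun i j k hj _ _ hk hkΨ ↦ hcl k hkΨ j hj i (by rw [hk, sub_add_cancel])) hi

/-- A root subsystem contains all short roots of the lattice which it spans. -/
lemma IsRootSubsystem.mem_of_root_mem_span {Φ : RootPairing ι ℂ V V'} [Finite ι]
    [Φ.IsCrystallographic] [Φ.IsReduced] {Ψ : Set ι} (hΨ : IsRootSubsystem Φ Ψ) {i : ι}
    (hs : ∀ j, |Φ.pairingIn ℤ i j| ≤ |Φ.pairingIn ℤ j i|)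
    (hi : Φ.root i ∈ span ℤ (Φ.root '' Ψ)) : i ∈ Ψ := by
  refine root_mem_span_induction hΨ
    (C := fun i ↦ (∀ j, |Φ.pairingIn ℤ i j| ≤ |Φ.pairingIn ℤ j i|) → i ∈ Ψ) (fun i hi _ ↦ hi)
    (fun i j k hj hij hpos hk ih hs ↦ ?_) hi hs
  -- For short i the positive pairing must be 1, so subtracting j is the reflection s_j; it
  -- preserves shortness and can be undone inside Ψ.
  have h1 : Φ.pairingIn ℤ i j = 1 := by
    have := Φ.pairingIn_pairingIn_mem_set_of_isCrystal_of_isRed' (i := i) (j := j)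
      (Φ.root.injective.ne hij) (by
        intro h
        rw [Φ.root_eq_neg_iff] at h
        rw [h, Φ.pairingIn_reflectionPerm_self_left, Φ.pairingIn_same] at hpos
        lia)
    have hsj := hs j
    simp only [Set.mem_insert_iff, Set.mem_singleton_iff, Prod.mk.injEq] at this
    rcases this with h | h | h | h | h | h | h | h | h | h | h <;> simp_all
  have hkr : k = Φ.reflectionPerm j i := by
    apply Φ.root.injective
    rw [hk, Φ.root_reflectionPerm, Φ.reflection_apply_root' ℤ, h1, one_smul]
  have hkΨ := ih fun l ↦ by
    have := hs (Φ.reflectionPerm j l)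
    rw [Φ.pairingIn_reflectionPerm] at this
    rwa [hkr, Φ.pairingIn_reflectionPerm ℤ j l i]
  have := hΨ.2 k hkΨ j hj
  rwa [hkr, Φ.reflectionPerm_self] at this

/-- A root violating both alternatives would have a strictly shorter and a strictly longer
companion, but an irreducible system has at most two root lengths. -/
lemma forall_abs_pairingIn_le_or (Φ : RootPairing ι ℂ V V') [Finite ι] [Φ.IsCrystallographic]
    [Φ.IsReduced] [Φ.IsIrreducible] (i : ι) :
    (∀ j, |Φ.pairingIn ℤ i j| ≤ |Φ.pairingIn ℤ j i|) ∨
      (∀ j, |Φ.pairingIn ℤ j i| ≤ |Φ.pairingIn ℤ i j|) := by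
  have : Fintype ι := Fintype.ofFinite ι
  have : Nonempty ι := ⟨i⟩
  by_contra! h
  obtain ⟨⟨j, hj⟩, k, hk⟩ := h
  set B := Φ.posRootForm ℤ
  have hlen {a c : ι} (h : |Φ.pairingIn ℤ a c| < |Φ.pairingIn ℤ c a|) :
      B.rootLength a < B.rootLength c := by
    have h1 := congrArg abs (B.pairingIn_mul_eq_pairingIn_mul_swap a c)
    rw [abs_mul, abs_mul, abs_of_pos (B.rootLength_pos a), abs_of_pos (B.rootLength_pos c)] at h1
    have := B.rootLength_pos a
    have := B.rootLength_pos c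
    by_contra! hle
    have h2 := abs_nonneg (Φ.pairingIn ℤ a c)
    nlinarith
  have h1 := hlen hj
  have h2 := hlen hk
  obtain ⟨a, c, h⟩ := B.toInvariantForm.exists_apply_eq_or
  have h' (k : ι) : B.rootLength k = B.rootLength a ∨ B.rootLength k = B.rootLength c := by
    simpa only [RootPairing.RootPositiveForm.toInvariantForm_form, ← B.algebraMap_rootLength,
      (FaithfulSMul.algebraMap_injective ℤ ℂ).eq_iff] using h k
  rcases h' i with hi | hi <;> rcases h' j with hj' | hj' <;> rcases h' k with hk' | hk' <;> lia

/-- A proper root subsystem cannot span both the root lattice and the coroot lattice. -/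
lemma IsRootSubsystem.eq_univ_of_span_eq {Φ : RootPairing ι ℂ V V'} [Finite ι]
    [Φ.IsCrystallographic] [Φ.IsReduced] [Φ.IsIrreducible] {Ψ : Set ι} (hΨ : IsRootSubsystem Φ Ψ)
    (h : ∀ i, Φ.root i ∈ span ℤ (Φ.root '' Ψ)) (h' : ∀ i, Φ.coroot i ∈ span ℤ (Φ.coroot '' Ψ)) :
    Ψ = Set.univ := by
  refine Set.eq_univ_of_forall fun i ↦ ?_
  rcases forall_abs_pairingIn_le_or Φ i with hi | hi
  · exact hΨ.mem_of_root_mem_span hi (h i)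
  · exact hΨ.flip.mem_of_root_mem_span (by simpa only [pairingIn_flip] using hi) (h' i)

end Subsystems

/-! ### The invariant form as a map from roots to multiples of coroots -/

section Form

variable {ι V V' : Type*} [AddCommGroup V] [Module ℂ V] [AddCommGroup V'] [Module ℂ V']
  {Φ : RootPairing ι ℂ V V'} [Φ.IsRootSystem]

/-- The isomorphism `𝔥^* ≃ 𝔥` sending `α_i` to `d_i α_i^∨`. -/
noncomputable def formEquiv (b : Φ.Base) (d : b.support → ℕ) (hd : IsSymmetrizer b d) :
    V ≃ₗ[ℂ] V' :=
  b.toWeightBasis.equiv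
    (b.toCoweightBasis.unitsSMul fun i ↦ Units.mk0 (d i : ℂ) (by exact_mod_cast (hd.1 i).ne'))
    (Equiv.refl _)

variable {b : Φ.Base} {d : b.support → ℕ} (hd : IsSymmetrizer b d)

lemma formEquiv_simple (i : b.support) :
    formEquiv b d hd (Φ.root i) = (d i : ℂ) • Φ.coroot i := by
  rw [← b.toWeightBasis_apply, formEquiv, Basis.equiv_apply]
  simp [Basis.unitsSMul_apply, Units.smul_def]

lemma form_simple (b : Φ.Base) (d : b.support → ℕ) (i j : b.support) :
    form b d (Φ.root i) (Φ.root j) = d i * Φ.pairing j i := by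
  classical
  have := congrFun₂ (LinearMap.BilinForm.toMatrix_toBilin b.toWeightBasis
    (Matrix.of fun i j : b.support => (d i : ℂ) * Φ.pairing j i)) i j
  rw [LinearMap.BilinForm.toMatrix_apply] at this
  simpa [form] using this

lemma form_eq (x y : V) : form b d x y = Φ.toLinearMap y (formEquiv b d hd x) := by
  suffices form b d = Φ.toLinearMap.flip ∘ₗ (formEquiv b d hd).toLinearMap by
    rw [this]; rfl
  refine b.toWeightBasis.ext fun i ↦ b.toWeightBasis.ext fun j ↦ ?_
  simp [formEquiv_simple, form_simple]

include hd in
lemma form_comm (x y : V) : form b d x y = form b d y x := by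
  suffices form b d = LinearMap.flip (form b d) from LinearMap.congr_fun₂ this x y
  refine b.toWeightBasis.ext fun i ↦ b.toWeightBasis.ext fun j ↦ ?_
  rw [LinearMap.flip_apply, b.toWeightBasis_apply, b.toWeightBasis_apply, form_simple, form_simple]
  exact hd.2.2 i j

lemma formEquiv_reflection (j : b.support) (x : V) :
    formEquiv b d hd (Φ.reflection j x) = Φ.coreflection j (formEquiv b d hd x) := by
  suffices (formEquiv b d hd).toLinearMap ∘ₗ (Φ.reflection j).toLinearMap =
      (Φ.coreflection j).toLinearMap ∘ₗ (formEquiv b d hd).toLinearMap from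
    LinearMap.congr_fun this x
  refine b.toWeightBasis.ext fun i ↦ ?_
  simp only [LinearMap.comp_apply, LinearEquiv.coe_coe, RootPairing.Base.toWeightBasis_apply,
    RootPairing.reflection_apply_root, map_sub, map_smul, formEquiv_simple,
    RootPairing.coreflection_apply_coroot, smul_sub, smul_smul]
  rw [mul_comm, hd.2.2 j i]

variable [Finite ι] [Φ.IsCrystallographic] [Φ.IsReduced]

/-- Every root is reached from a simple one by simple reflections, which commute with `formEquiv`
and so carry the factor d_k along. -/
lemma exists_formEquiv_root (i : ι) :
    ∃ k, formEquiv b d hd (Φ.root i) = (d k : ℂ) • Φ.coroot i := by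
  refine b.induction_reflect i
    (p := fun i ↦ ∃ k, formEquiv b d hd (Φ.root i) = (d k : ℂ) • Φ.coroot i) (fun i ⟨k, hk⟩ ↦ ⟨k, by simp [hk]⟩)
    (fun i hi ↦ ⟨⟨i, hi⟩, formEquiv_simple hd ⟨i, hi⟩⟩) (fun i j ⟨k, hk⟩ hj ↦ ⟨k, ?_⟩)
  rw [Φ.root_reflectionPerm, formEquiv_reflection hd ⟨j, hj⟩, hk, map_smul, Φ.coroot_reflectionPerm]

/-- The index of a simple root of the same length as a given root. -/
noncomputable def simpleOfLength (i : ι) : b.support := (exists_formEquiv_root hd i).choose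

/-- Half the square length of a root. -/
noncomputable def halfLength (i : ι) : ℕ := d (simpleOfLength hd i)

lemma formEquiv_root (i : ι) :
    formEquiv b d hd (Φ.root i) = (halfLength hd i : ℂ) • Φ.coroot i :=
  (exists_formEquiv_root hd i).choose_spec

lemma halfLength_pos (i : ι) : 0 < halfLength hd i := hd.1 _

lemma halfLength_eq_of {i : ι} {n : ℕ} (h : formEquiv b d hd (Φ.root i) = (n : ℂ) • Φ.coroot i) :
    halfLength hd i = n := by
  rw [formEquiv_root] at h
  exact_mod_cast smul_left_injective ℂ (Φ.ne_zero' i) h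

lemma halfLength_simple (i : b.support) : halfLength hd i = d i :=
  halfLength_eq_of hd (formEquiv_simple hd i)

lemma halfLength_reflectionPerm (j : b.support) (i : ι) :
    halfLength hd (Φ.reflectionPerm j i) = halfLength hd i := by
  apply halfLength_eq_of
  rw [Φ.root_reflectionPerm, formEquiv_reflection hd j, formEquiv_root, map_smul,
    Φ.coroot_reflectionPerm]

lemma form_root_left (i : ι) (x : V) :
    form b d (Φ.root i) x = halfLength hd i * Φ.coroot' i x := by
  rw [form_eq hd, formEquiv_root, map_smul, smul_eq_mul, LinearMap.flip_apply]

lemma form_root_right (i : ι) (x : V) :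
    form b d x (Φ.root i) = halfLength hd i * Φ.coroot' i x := by
  rw [form_comm hd, form_root_left hd]

include hd in
/-- A set of roots spans `𝔥^*` if the coroots span `𝔥`. -/
lemma span_root_eq_top_of_span_coroot {S : Set ι} (h : span ℂ (Φ.coroot '' S) = ⊤) :
    span ℂ (Φ.root '' S) = ⊤ := by
  apply Submodule.map_injective_of_injective (formEquiv b d hd).injective
  rw [Submodule.map_top, LinearEquiv.range, eq_top_iff, ← h, Submodule.span_le]
  rintro - ⟨i, hi, rfl⟩
  refine ⟨(halfLength hd i : ℂ)⁻¹ • Φ.root i, Submodule.smul_mem _ _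
    (subset_span (Set.mem_image_of_mem _ hi)), ?_⟩
  have : (halfLength hd i : ℂ) ≠ 0 := by exact_mod_cast (halfLength_pos hd i).ne'
  simp [formEquiv_root, smul_smul, this]

/-- The roots of a `halfLength` divisible by `p` span `𝔥^*`, unless there are none. -/
lemma span_root_halfLength_eq_top [Φ.IsIrreducible] (p : ℕ) {i : ι} (hi : p ∣ halfLength hd i) :
    span ℂ (Φ.root '' {i | p ∣ halfLength hd i}) = ⊤ := by
  -- The span is nonzero and stable under simple reflections, as these preserve length;
  -- irreducibility finishes.
  refine RootPairing.IsIrreducible.eq_top_of_invtSubmodule_reflection (P := Φ) _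
    ((b.forall_mem_support_invtSubmodule_iff _).mp fun j hj ↦ ?_) ?_
  · rw [Module.End.mem_invtSubmodule, ← Submodule.map_le_iff_le_comap, Submodule.map_span,
      Submodule.span_le]
    rintro - ⟨-, ⟨k, hk, rfl⟩, rfl⟩
    refine subset_span ⟨Φ.reflectionPerm j k, ?_, Φ.root_reflectionPerm j k⟩
    rw [Set.mem_ofPred_eq] at hk ⊢
    rwa [halfLength_reflectionPerm hd ⟨j, hj⟩]
  · intro h
    have := subset_span (R := ℂ) (Set.mem_image_of_mem Φ.root (a := {i | p ∣ halfLength hd i}) hi)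
    rw [h] at this
    exact Φ.ne_zero i (by simpa using this)

end Form

/-! ### Integral functionals on the root lattice -/

section Lattices

variable {ι V V' : Type*} [AddCommGroup V] [Module ℂ V] [AddCommGroup V'] [Module ℂ V']
  {Φ : RootPairing ι ℂ V V'}

lemma toWeightBasisInt_eq (b : Φ.Base) (i : b.support) :
    b.toWeightBasisInt i = Φ.rootSpanMem ℤ i := by
  ext; simp

variable [Φ.IsRootSystem]

/-- The extension of an integral functional on the root lattice to `𝔥^*`. -/
noncomputable def extendInt (b : Φ.Base) (u : Φ.rootSpan ℤ →ₗ[ℤ] ℤ) : V →ₗ[ℂ] ℂ :=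
  b.toWeightBasis.constr ℂ fun i ↦ (u (Φ.rootSpanMem ℤ i) : ℂ)

lemma extendInt_apply (b : Φ.Base) (u : Φ.rootSpan ℤ →ₗ[ℤ] ℤ) (x : Φ.rootSpan ℤ) :
    extendInt b u x = u x := by
  suffices (extendInt b u).restrictScalars ℤ ∘ₗ (Φ.rootSpan ℤ).subtype =
      (Algebra.linearMap ℤ ℂ) ∘ₗ u by simpa using LinearMap.congr_fun this x
  refine b.toWeightBasisInt.ext fun i ↦ ?_
  rw [toWeightBasisInt_eq]
  have : extendInt b u (Φ.root i) = u (Φ.rootSpanMem ℤ i) := by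
    rw [extendInt, ← b.toWeightBasis_apply, Basis.constr_basis]
  simpa using this

lemma eq_zero_of_span_root_eq_top (b : Φ.Base) {S : Set ι} (h : span ℂ (Φ.root '' S) = ⊤)
    {u : Φ.rootSpan ℤ →ₗ[ℤ] ℤ} (hu : ∀ i ∈ S, u (Φ.rootSpanMem ℤ i) = 0) : u = 0 := by
  have h0 : extendInt b u = 0 := by
    apply LinearMap.ext_on h
    rintro - ⟨i, hi, rfl⟩
    simpa [hu i hi] using extendInt_apply b u (Φ.rootSpanMem ℤ i)
  refine LinearMap.ext fun x ↦ ?_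
  have := extendInt_apply b u x
  rw [h0, LinearMap.zero_apply] at this
  exact_mod_cast this.symm

end Lattices

/-! ### Borel–de Siebenthal theory by alcove geometry -/

section

variable {ι V V' : Type*} [AddCommGroup V] [Module ℂ V] [AddCommGroup V'] [Module ℂ V']
  {Φ : RootPairing ι ℂ V V'}

/-- A functional `u` on the root lattice not divisible by `p` such that the roots on which `u` is
divisible by `p` have full rank. -/
def IsFullRankMod (Φ : RootPairing ι ℂ V V') (p : ℤ) (u : Φ.rootSpan ℤ →ₗ[ℤ] ℤ) : Prop :=
  (∀ φ : Φ.rootSpan ℤ →ₗ[ℤ] ℤ,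
    (∀ i, p ∣ u (Φ.rootSpanMem ℤ i) → φ (Φ.rootSpanMem ℤ i) = 0) → φ = 0) ∧
  ∃ i, ¬ p ∣ u (Φ.rootSpanMem ℤ i)

lemma nonneg_of_mem_closure (b : Φ.Base) {v : Φ.rootSpan ℤ →ₗ[ℤ] ℤ}
    (hv : ∀ i : b.support, 0 ≤ v (Φ.rootSpanMem ℤ i)) {x : Φ.rootSpan ℤ}
    (hx : (x : V) ∈ AddSubmonoid.closure (Φ.root '' b.support)) : 0 ≤ v x := by
  suffices ∀ y ∈ AddSubmonoid.closure (Φ.root '' b.support),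
      ∃ x : Φ.rootSpan ℤ, (x : V) = y ∧ 0 ≤ v x by
    obtain ⟨x', h, h0⟩ := this x hx
    rwa [Subtype.ext h] at h0
  intro y hy
  induction hy using AddSubmonoid.closure_induction with
  | mem y hy => obtain ⟨i, hi, rfl⟩ := hy; exact ⟨Φ.rootSpanMem ℤ i, rfl, hv ⟨i, hi⟩⟩
  | zero => exact ⟨0, rfl, (map_zero v).ge⟩
  | add y z _ _ hy hz =>
    obtain ⟨y, rfl, hy⟩ := hy
    obtain ⟨z, rfl, hz⟩ := hz
    exact ⟨y + z, rfl, (map_add v y z).symm ▸ add_nonneg hy hz⟩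

lemma gammaConst_ne_zero (b : Φ.Base) (θ : ι) : gammaConst b θ ≠ 0 := by
  rw [gammaConst, Ne, Finset.lcm_eq_zero_iff]
  rintro ⟨i, hi, h0⟩
  exact (Finset.mem_filter.mp hi).2.ne_zero h0

variable [Φ.IsCrystallographic]

/-- Reindexing by s_a flips the sign of the pairing. This makes the change of the invariant norm
under a reflection in a depend on v only through v(a). -/
lemma two_mul_sum_mul_pairingIn [Fintype ι] (v : Φ.rootSpan ℤ →ₗ[ℤ] ℤ) (a : ι) :
    2 * ∑ i, v (Φ.rootSpanMem ℤ i) * Φ.pairingIn ℤ i a =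
      v (Φ.rootSpanMem ℤ a) * ∑ i, Φ.pairingIn ℤ i a ^ 2 := by
  have h : ∑ i, v (Φ.rootSpanMem ℤ i) * Φ.pairingIn ℤ i a =
      ∑ i, (v (Φ.rootSpanMem ℤ i) - Φ.pairingIn ℤ i a * v (Φ.rootSpanMem ℤ a)) *
        -Φ.pairingIn ℤ i a := by
    rw [← Equiv.sum_comp (Φ.reflectionPerm a)]
    refine Finset.sum_congr rfl fun i _ ↦ ?_
    rw [rootSpanMem_reflectionPerm, map_sub, map_smul, smul_eq_mul,
      ← Φ.pairingIn_reflectionPerm ℤ, Φ.pairingIn_reflectionPerm_self_right]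
  rw [two_mul]
  nth_rw 1 [h]
  rw [← Finset.sum_add_distrib, Finset.mul_sum]
  refine Finset.sum_congr rfl fun i _ ↦ ?_
  ring

/-- The affine reflection of a functional in the hyperplane on which the root `a` takes the
value `c`. -/
noncomputable def affineReflection (a : ι) (c : ℤ) (u : Φ.rootSpan ℤ →ₗ[ℤ] ℤ) : Φ.rootSpan ℤ →ₗ[ℤ] ℤ :=
  u - (u (Φ.rootSpanMem ℤ a) - c) • Φ.coroot'In ℤ a

lemma affineReflection_root (a : ι) (c : ℤ) (u : Φ.rootSpan ℤ →ₗ[ℤ] ℤ) (i : ι) :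
    affineReflection a c u (Φ.rootSpanMem ℤ i) =
      u (Φ.rootSpanMem ℤ i) - (u (Φ.rootSpanMem ℤ a) - c) * Φ.pairingIn ℤ i a := by
  simp [affineReflection, Φ.coroot'In_rootSpanMem_eq_pairingIn]

/-- Modulo p the affine reflection is the linear one, so it moves the locus of roots killed mod p by
s_a. -/
lemma dvd_affineReflection_reflectionPerm_iff (a : ι) (p k : ℤ) (u : Φ.rootSpan ℤ →ₗ[ℤ] ℤ) (i : ι) :
    p ∣ affineReflection a (k * p) u (Φ.rootSpanMem ℤ (Φ.reflectionPerm a i)) ↔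
      p ∣ u (Φ.rootSpanMem ℤ i) := by
  rw [affineReflection_root, rootSpanMem_reflectionPerm, map_sub, map_smul, smul_eq_mul,
    ← Φ.pairingIn_reflectionPerm ℤ, Φ.pairingIn_reflectionPerm_self_right]
  have : u (Φ.rootSpanMem ℤ i) - Φ.pairingIn ℤ i a * u (Φ.rootSpanMem ℤ a) -
      (u (Φ.rootSpanMem ℤ a) - k * p) * -Φ.pairingIn ℤ i a =
      u (Φ.rootSpanMem ℤ i) - (k * Φ.pairingIn ℤ i a) * p := by ring
  rw [this, dvd_sub_left (dvd_mul_left _ _)]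

lemma IsFullRankMod.affineReflection {p : ℤ} {u : Φ.rootSpan ℤ →ₗ[ℤ] ℤ}
    (hu : IsFullRankMod Φ p u) (a : ι) (k : ℤ) :
    IsFullRankMod Φ p (affineReflection a (k * p) u) := by
  refine ⟨fun φ hφ ↦ ?_, ?_⟩
  -- With c = 0 this is the linear reflection of the test functional φ.
  · have h := hu.1 (QRoot.affineReflection a 0 φ) fun i hi ↦ by
      have := hφ (Φ.reflectionPerm a i) ((dvd_affineReflection_reflectionPerm_iff a p k u i).mpr hi)
      rw [rootSpanMem_reflectionPerm, map_sub, map_smul, smul_eq_mul] at this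
      rw [affineReflection_root]
      linarith
    have ha : φ (Φ.rootSpanMem ℤ a) = 0 := by
      have := LinearMap.congr_fun h (Φ.rootSpanMem ℤ a)
      rw [affineReflection_root, Φ.pairingIn_same, LinearMap.zero_apply] at this
      linarith
    rwa [QRoot.affineReflection, ha, sub_zero, zero_smul, sub_zero] at h
  · obtain ⟨i, hi⟩ := hu.2
    exact ⟨Φ.reflectionPerm a i, (dvd_affineReflection_reflectionPerm_iff a p k u i).not.mpr hi⟩

/-- A functional in the orbit of the affine Weyl group which is closest to `M⁻¹ h` lies on the same
side of each affine reflection hyperplane as `M⁻¹ h`. -/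
lemma IsFullRankMod.exists_mul_nonneg [Finite ι] {p : ℤ} {u : Φ.rootSpan ℤ →ₗ[ℤ] ℤ}
    (hu : IsFullRankMod Φ p u) (h : Φ.rootSpan ℤ →ₗ[ℤ] ℤ) {M : ℤ} (hM : 0 < M) :
    ∃ v, IsFullRankMod Φ p v ∧ ∀ (a : ι) (k : ℤ),
      0 ≤ (v (Φ.rootSpanMem ℤ a) - k * p) * (h (Φ.rootSpanMem ℤ a) - M * (k * p)) := by
  have := Fintype.ofFinite ι
  -- M² times the squared distance from v to h/M in a Weyl-invariant form, scaled to stay integral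
  -- so that a minimum exists.
  let N (v : Φ.rootSpan ℤ →ₗ[ℤ] ℤ) : ℤ :=
    ∑ i, (M * v (Φ.rootSpanMem ℤ i) - h (Φ.rootSpanMem ℤ i)) ^ 2
  have hN (v) : 0 ≤ N v := Finset.sum_nonneg fun i _ ↦ sq_nonneg _
  obtain ⟨v, hv⟩ := exists_minimalFor_of_wellFoundedLT (IsFullRankMod Φ p) (fun v ↦ (N v).toNat)
    ⟨u, hu⟩
  refine ⟨v, hv.prop, fun a k ↦ ?_⟩
  have hle : N v ≤ N (QRoot.affineReflection a (k * p) v) := by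
    have := hv.le (hv.prop.affineReflection a k)
    have := hN v
    have := hN (QRoot.affineReflection a (k * p) v)
    lia
  set c := v (Φ.rootSpanMem ℤ a) - k * p with hc
  set D := ∑ i, Φ.pairingIn ℤ i a ^ 2 with hD
  have hDpos : 0 < D := Finset.sum_pos' (fun i _ ↦ sq_nonneg _)
    ⟨a, Finset.mem_univ a, by rw [Φ.pairingIn_same]; norm_num⟩
  have hexp : N (QRoot.affineReflection a (k * p) v) = N v -
      M * c * (2 * ∑ i, (M • v - h) (Φ.rootSpanMem ℤ i) * Φ.pairingIn ℤ i a) +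
        M ^ 2 * c ^ 2 * D := by
    simp only [N, hD, Finset.mul_sum, ← Finset.sum_sub_distrib, ← Finset.sum_add_distrib]
    refine Finset.sum_congr rfl fun i _ ↦ ?_
    rw [affineReflection_root, ← hc]
    simp only [LinearMap.sub_apply, LinearMap.smul_apply, smul_eq_mul]
    ring
  rw [two_mul_sum_mul_pairingIn, LinearMap.sub_apply, LinearMap.smul_apply, smul_eq_mul] at hexp
  -- The left factor times the claimed product is exactly the increase of N under the reflection,
  -- nonnegative by minimality.
  have h2 : 0 ≤ (M * D) * (c * (h (Φ.rootSpanMem ℤ a) - M * (k * p))) := by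
    have : (M * D) * (c * (h (Φ.rootSpanMem ℤ a) - M * (k * p))) =
        N (QRoot.affineReflection a (k * p) v) - N v := by
      rw [hexp, hc]; ring
    lia
  exact nonneg_of_mul_nonneg_right h2 (by positivity)

/-- **Borel–de Siebenthal**: the primes which occur as index of a full rank maximal subsystem are
coefficients of the highest root. -/
theorem IsFullRankMod.exists_absCoeff_eq [Finite ι] (b : Φ.Base) {θ : ι} (hθ : IsHighestRoot b θ)
    {p : ℕ} (hp : p.Prime) {u : Φ.rootSpan ℤ →ₗ[ℤ] ℤ} (hu : IsFullRankMod Φ p u) :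
    ∃ i, absCoeff b θ i = p := by
  classical
  set β := b.toWeightBasisInt with hβ
  set r : ι → Φ.rootSpan ℤ := Φ.rootSpanMem ℤ with hr
  have hβr (i : b.support) : β i = r i := toWeightBasisInt_eq b i
  have hcoord (i j : b.support) : β.coord i (r j) = if j = i then 1 else 0 := by
    rw [← hβr, Basis.coord_apply, Basis.repr_self, Finsupp.single_apply]
  have hcoord_nonneg (i j : b.support) : 0 ≤ β.coord i (r j) := by
    rw [hcoord]; split_ifs <;> norm_num
  have hneg (i : ι) : r (Φ.reflectionPerm i i) = -r i := Φ.rootSpanMem_reflectionPerm_self ℤ i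
  have htop {v : Φ.rootSpan ℤ →ₗ[ℤ] ℤ} (hv : ∀ i : b.support, 0 ≤ v (r i)) (j : ι) :
      v (r j) ≤ v (r θ) := by
    have := nonneg_of_mem_closure b hv (x := r θ - r j) (hθ j)
    rw [map_sub] at this
    lia
  set h : Φ.rootSpan ℤ →ₗ[ℤ] ℤ := β.constr ℤ fun _ ↦ 1 with hh
  have hh1 (i : b.support) : h (r i) = 1 := by rw [← hβr, hh, Basis.constr_basis]
  have hhθ : 0 ≤ h (r θ) := by
    have := htop (v := h) (fun i ↦ by rw [hh1]; norm_num)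
    have h1 := this θ
    have h2 := this (Φ.reflectionPerm θ θ)
    rw [hneg, map_neg] at h2
    lia
  have hp0 : (0 : ℤ) < p := by exact_mod_cast hp.pos
  -- Here h is the height. With this M, h/M is positive on simple roots and below 1 ≤ p on θ, hence
  -- interior to the alcove; so v lies in its closure.
  obtain ⟨v, hv, hineq⟩ := hu.exists_mul_nonneg h (M := h (r θ) + 1) (by lia)
  have hv0 (i : b.support) : 0 ≤ v (r i) := by
    have := hineq i 0
    rw [← hr] at this
    simpa [hh1] using this
  have hvθ : v (r θ) ≤ p := by
    by_contra! hlt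
    have := hineq θ 1
    rw [one_mul, ← hr] at this
    have h1 : h (r θ) - (h (r θ) + 1) * p < 0 := by nlinarith
    have h2 : (v (r θ) - p) * (h (r θ) - (h (r θ) + 1) * p) < 0 :=
      mul_neg_of_pos_of_neg (by lia) h1
    lia
  obtain ⟨i₀, hi₀⟩ := hv.2
  have hv_ne : v ≠ 0 := by
    rintro rfl
    simp at hi₀
  -- it suffices to test the vanishing of functionals on positive roots
  have hpos {φ : Φ.rootSpan ℤ →ₗ[ℤ] ℤ}
      (hφ : ∀ i, (r i : V) ∈ AddSubmonoid.closure (Φ.root '' b.support) →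
        (v (r i) = 0 ∨ v (r i) = p) → φ (r i) = 0) : φ = 0 := by
    refine hv.1 φ fun i hi ↦ ?_
    have aux (i : ι) (hc : (r i : V) ∈ AddSubmonoid.closure (Φ.root '' b.support))
        (hi : (p : ℤ) ∣ v (r i)) : φ (r i) = 0 := by
      refine hφ i hc ?_
      have h1 := nonneg_of_mem_closure b hv0 hc
      have h2 := (htop hv0 i).trans hvθ
      obtain ⟨c, hc⟩ := hi
      rw [hc] at h1 h2 ⊢
      have h3 : 0 ≤ c := nonneg_of_mul_nonneg_right h1 hp0
      have h4 : c ≤ 1 := by nlinarith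
      obtain rfl | rfl : c = 0 ∨ c = 1 := by lia
      · simp
      · simp
    rcases b.root_mem_or_neg_mem i with hc | hc
    · exact aux i hc hi
    · have := aux (Φ.reflectionPerm i i) (by simpa [hneg, hr] using hc)
        (by rw [hneg, map_neg]; exact hi.neg_right)
      rwa [hneg, map_neg, neg_eq_zero] at this
  -- If v(θ) < p, every positive root killed mod p is killed by v itself, and full rank would give v
  -- = 0.
  have hvθ' : v (r θ) = p := by
    by_contra hne
    refine hv_ne (hpos fun i _ hi ↦ hi.resolve_right fun h ↦ hne ?_)
    have := htop hv0 i
    lia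
  have hzero {x : Φ.rootSpan ℤ} (hx : (x : V) ∈ AddSubmonoid.closure (Φ.root '' b.support))
      (hvx : v x = 0) {i : b.support} (hi : 0 < v (r i)) : β.coord i x = 0 := by
    have h1 := nonneg_of_mem_closure b (hcoord_nonneg i) hx
    have h2 := nonneg_of_mem_closure b (v := v - v (r i) • β.coord i) (fun j ↦ by
      rw [← hr, LinearMap.sub_apply, LinearMap.smul_apply, smul_eq_mul, hcoord]
      split_ifs with hji
      · simp [hji]
      · simpa using hv0 j) hx
    rw [LinearMap.sub_apply, LinearMap.smul_apply, smul_eq_mul, hvx] at h2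
    nlinarith
  have hθcoord (i : b.support) : 1 ≤ β.coord i (r θ) := by
    have := htop (hcoord_nonneg i) i
    rwa [hcoord, if_pos rfl] at this
  obtain ⟨i, hi⟩ : ∃ i : b.support, 0 < v (r i) := by
    by_contra! hall
    refine hv_ne (β.ext fun i ↦ ?_)
    rw [hβr, LinearMap.zero_apply]
    exact le_antisymm (hall i) (hv0 i)
  have hother (j : b.support) (hji : j ≠ i) : v (r j) = 0 := by
    by_contra hne
    have hj : 0 < v (r j) := lt_of_le_of_ne (hv0 j) (Ne.symm hne)
    -- Positive roots with v = 0 have no α_i or α_j component; those with v = p have the same two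
    -- components as θ. So this functional vanishes on the locus, yet it is nonzero at α_i.
    have hφ : β.coord j (r θ) • β.coord i - β.coord i (r θ) • β.coord j = 0 := by
      refine hpos fun k hk hvk ↦ ?_
      simp only [LinearMap.sub_apply, LinearMap.smul_apply, smul_eq_mul]
      rcases hvk with hvk | hvk
      · rw [hzero hk hvk hi, hzero hk hvk hj, mul_zero, mul_zero, sub_zero]
      · have hx := hθ k
        have hv' : v (r θ - r k) = 0 := by rw [map_sub, hvk, hvθ', sub_self]
        have e1 := hzero (x := r θ - r k) hx hv' hi
        have e2 := hzero (x := r θ - r k) hx hv' hj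
        rw [map_sub, sub_eq_zero] at e1 e2
        rw [← e1, ← e2]
        ring
    have := LinearMap.congr_fun hφ (r i)
    simp only [LinearMap.sub_apply, LinearMap.smul_apply, smul_eq_mul, hcoord,
      LinearMap.zero_apply] at this
    rw [if_pos trivial, if_neg hji.symm] at this
    have := hθcoord j
    lia
  have hvi : v = v (r i) • β.coord i := β.ext fun j ↦ by
    rw [hβr, LinearMap.smul_apply, smul_eq_mul, hcoord]
    split_ifs with hji
    · rw [hji, mul_one]
    · rw [hother j hji, mul_zero]
  have hprod : v (r i) * β.coord i (r θ) = p := by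
    rw [← hvθ']
    exact (LinearMap.congr_fun hvi (r θ)).symm
  refine ⟨i, ?_⟩
  have hprod' : (v (r i)).natAbs * absCoeff b θ i = p := by
    rw [absCoeff, ← Int.natAbs_mul]
    exact congrArg Int.natAbs hprod
  rcases (Nat.dvd_prime hp).mp (Dvd.intro_left _ hprod') with h1 | h1
  · exfalso
    rw [h1, mul_one] at hprod'
    apply hi₀
    rw [← hr, hvi, LinearMap.smul_apply, smul_eq_mul]
    exact Dvd.dvd.mul_right (by rw [← hprod', Int.natCast_natAbs, abs_dvd]) _
  · exact h1

/-- A full rank functional modulo `p` on the coroot lattice yields one on the root lattice. -/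
theorem exists_isFullRankMod_of_coroot [Finite ι] [Φ.IsRootSystem] [Φ.IsReduced]
    [Φ.IsIrreducible] {b : Φ.Base} {d : b.support → ℕ} (hd : IsSymmetrizer b d) {p : ℕ}
    (hp : p.Prime) {w : Φ.flip.rootSpan ℤ →ₗ[ℤ] ℤ}
    (hw : span ℂ (Φ.root '' {i | (p : ℤ) ∣ w (Φ.flip.rootSpanMem ℤ i)}) = ⊤)
    (hne : ∃ i, ¬ (p : ℤ) ∣ w (Φ.flip.rootSpanMem ℤ i)) :
    ∃ u, IsFullRankMod Φ p u := by
  classical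
  -- The integral form of `formEquiv`: it sends each root to `halfLength` times its coroot.
  let ν : Φ.rootSpan ℤ →ₗ[ℤ] Φ.flip.rootSpan ℤ :=
    b.toWeightBasisInt.constr ℤ fun i ↦ (d i : ℤ) • Φ.flip.rootSpanMem ℤ i
  have hνi (i : b.support) : ν (Φ.rootSpanMem ℤ i) = (d i : ℤ) • Φ.flip.rootSpanMem ℤ i := by
    rw [← toWeightBasisInt_eq b, Basis.constr_basis]
  have hνC (x : Φ.rootSpan ℤ) : (ν x : V') = formEquiv b d hd x := by
    suffices (Φ.flip.rootSpan ℤ).subtype ∘ₗ ν =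
        (formEquiv b d hd).toLinearMap.restrictScalars ℤ ∘ₗ (Φ.rootSpan ℤ).subtype from
      LinearMap.congr_fun this x
    refine b.toWeightBasisInt.ext fun i ↦ ?_
    have := formEquiv_simple hd i
    simp only [LinearMap.comp_apply, toWeightBasisInt_eq, hνi]
    simpa [Nat.cast_smul_eq_nsmul] using this.symm
  have hν (i : ι) : ν (Φ.rootSpanMem ℤ i) = (halfLength hd i : ℤ) • Φ.flip.rootSpanMem ℤ i := by
    ext
    rw [hνC]
    have := formEquiv_root hd i
    simpa [Nat.cast_smul_eq_nsmul] using this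
  by_cases hpd : ∃ i, p ∣ d i
  · obtain ⟨i, hi⟩ := hpd
    obtain ⟨j, hj⟩ : ∃ j, ¬ p ∣ d j := by
      by_contra! hall
      have := Finset.dvd_gcd fun j (_ : j ∈ Finset.univ) ↦ hall j
      rw [hd.2.1] at this
      exact hp.one_lt.ne' (Nat.dvd_one.mp this)
    -- If p ∣ `halfLength` of α, comparing α_j-coordinates through ν shows that p divides d_j times
    -- the coordinate of α, hence the coordinate itself; such roots already span.
    refine ⟨b.toWeightBasisInt.coord j, fun φ hφ ↦ ?_, j, ?_⟩
    · refine eq_zero_of_span_root_eq_top b (span_root_halfLength_eq_top hd p (i := i)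
        (by rwa [halfLength_simple])) fun k hk ↦ hφ k ?_
      let j' : b.flip.support := j
      have hcomp : b.flip.toWeightBasisInt.coord j' ∘ₗ ν =
          (d j : ℤ) • b.toWeightBasisInt.coord j := by
        refine b.toWeightBasisInt.ext fun l ↦ ?_
        let l' : b.flip.support := l
        have hl : Φ.flip.rootSpanMem ℤ l = b.flip.toWeightBasisInt l' :=
          (toWeightBasisInt_eq b.flip l').symm
        rw [LinearMap.comp_apply, toWeightBasisInt_eq, hνi, map_smul, LinearMap.smul_apply, hl,
          ← toWeightBasisInt_eq b, Basis.coord_apply, Basis.coord_apply, Basis.repr_self,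
          Basis.repr_self, Finsupp.single_apply, Finsupp.single_apply]
        rcases eq_or_ne l j with rfl | hlj
        · rw [if_pos rfl, if_pos rfl]
        · have hlj' : l' ≠ j' := hlj
          rw [if_neg hlj', if_neg hlj, smul_zero, smul_zero]
      have := LinearMap.congr_fun hcomp (Φ.rootSpanMem ℤ k)
      rw [LinearMap.comp_apply, hν, map_smul, LinearMap.smul_apply, smul_eq_mul, smul_eq_mul]
        at this
      have h2 : (p : ℤ) ∣ d j * b.toWeightBasisInt.coord j (Φ.rootSpanMem ℤ k) := by
        rw [← this]
        exact (Int.natCast_dvd_natCast.mpr hk).mul_right _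
      exact ((Nat.prime_iff_prime_int.mp hp).dvd_or_dvd h2).resolve_left
        fun h ↦ hj (Int.natCast_dvd_natCast.mp h)
    · rw [← toWeightBasisInt_eq b, Basis.coord_apply, Basis.repr_self, Finsupp.single_eq_same]
      exact fun h ↦ hp.one_lt.ne' (Nat.dvd_one.mp (by exact_mod_cast h))
  -- All half-lengths are now prime to p, so w ∘ ν has the same locus as w.
  · push Not at hpd
    have hiff (i : ι) : (p : ℤ) ∣ (w ∘ₗ ν) (Φ.rootSpanMem ℤ i) ↔
        (p : ℤ) ∣ w (Φ.flip.rootSpanMem ℤ i) := by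
      rw [LinearMap.comp_apply, hν, map_smul, smul_eq_mul]
      refine ⟨fun h ↦ ?_, fun h ↦ h.mul_left _⟩
      exact ((Nat.prime_iff_prime_int.mp hp).dvd_or_dvd h).resolve_left
        fun h ↦ hpd (simpleOfLength hd i) (Int.natCast_dvd_natCast.mp h)
    refine ⟨w ∘ₗ ν, fun φ hφ ↦ eq_zero_of_span_root_eq_top b hw fun i hi ↦ hφ i ((hiff i).mpr hi), ?_⟩
    obtain ⟨i, hi⟩ := hne
    exact ⟨i, (hiff i).not.mpr hi⟩

lemma dvd_gammaConst [Finite ι] [Φ.IsRootSystem] [Φ.IsReduced]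
    [Φ.IsIrreducible] {b : Φ.Base} {d : b.support → ℕ} (hd : IsSymmetrizer b d) {θ : ι}
    (hθ : IsHighestRoot b θ) {p : ℕ} (hp : p.Prime) {w : Φ.flip.rootSpan ℤ →ₗ[ℤ] ℤ}
    (hw : span ℂ (Φ.root '' {i | (p : ℤ) ∣ w (Φ.flip.rootSpanMem ℤ i)}) = ⊤)
    (hne : ∃ i, ¬ (p : ℤ) ∣ w (Φ.flip.rootSpanMem ℤ i)) : p ∣ gammaConst b θ := by
  obtain ⟨u, hu⟩ := exists_isFullRankMod_of_coroot hd hp hw hne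
  obtain ⟨i, rfl⟩ := hu.exists_absCoeff_eq b hθ hp
  exact Finset.dvd_lcm (Finset.mem_filter.mpr ⟨Finset.mem_univ i, hp⟩)

end

/-! ### Weights with values in ℂ(q)(s) -/

section

variable {ι V V' : Type*} [AddCommGroup V] [Module ℂ V] [AddCommGroup V'] [Module ℂ V']
  {Φ : RootPairing ι ℂ V V'}

lemma qElt_ne_zero (s : K) : qElt s ≠ 0 :=
  (map_ne_zero _).mpr RatFunc.X_ne_zero

/-- The indeterminate `q` is not a root of unity. -/
lemma eq_zero_of_qElt_zpow_eq_one (s : K) {a : ℤ} (h : qElt s ^ a = 1) : a = 0 := by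
  have hX : (RatFunc.X : RatFunc ℂ) ^ a = 1 := by
    apply (algebraMap (RatFunc ℂ) (adjoinField s)).injective
    rw [map_zpow₀, map_one]
    exact h
  have hnat (n : ℕ) (hn : (RatFunc.X : RatFunc ℂ) ^ n = 1) : n = 0 := by
    have : (Polynomial.X : Polynomial ℂ) ^ n = 1 := by
      apply RatFunc.algebraMap_injective ℂ
      rw [map_pow, RatFunc.algebraMap_X, hn, map_one]
    simpa using congrArg Polynomial.natDegree this
  obtain ⟨n, rfl | rfl⟩ := a.eq_nat_or_neg
  · rw [zpow_natCast] at hX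
    exact_mod_cast hnat n hX
  · rw [zpow_neg, inv_eq_one, zpow_natCast] at hX
    simpa using hnat n hX

lemma gen_pow_eq_qElt {s : K} {m : ℕ} (hs : s ^ m = qK) :
    IntermediateField.AdjoinSimple.gen (RatFunc ℂ) s ^ m = qElt s :=
  Subtype.ext hs

lemma exists_isPrimitiveRoot (s : K) {n : ℕ} (hn : n ≠ 0) :
    ∃ ζ : adjoinField s, IsPrimitiveRoot ζ n :=
  ⟨_, (Complex.isPrimitiveRoot_exp n hn).map_of_injective
    ((algebraMap (RatFunc ℂ) (adjoinField s)).comp RatFunc.C).injective⟩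

lemma exists_weight {F : Type*} [Field F] {t : F} (ht : t ≠ 0) (c : Φ.rootSpan ℤ →ₗ[ℤ] ℤ) :
    ∃ Lam : Weight Φ F, ∀ μ, Lam (Kelt Φ F μ) = t ^ c μ := by
  let χ : Multiplicative (Φ.rootSpan ℤ) →* F :=
    { toFun := fun μ ↦ t ^ c μ.toAdd
      map_one' := by simp
      map_mul' := fun μ ν ↦ by rw [toAdd_mul, map_add, zpow_add₀ ht] }
  refine ⟨AddMonoidAlgebra.lift F F (Φ.rootSpan ℤ) χ, fun μ ↦ ?_⟩
  rw [Kelt, AddMonoidAlgebra.lift_single, one_smul]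
  rfl

section LinearWeights

variable [Φ.IsRootSystem]

lemma exists_weight_eq (b : Φ.Base) (w : Φ.flip.rootSpan ℤ →ₗ[ℤ] ℤ) :
    ∃ mu : V, ∀ i, Φ.coroot' i mu = w (Φ.flip.rootSpanMem ℤ i) := by
  refine ⟨Φ.toPerfPair.symm (extendInt b.flip w), fun i ↦ ?_⟩
  rw [← extendInt_apply b.flip]
  exact LinearMap.congr_fun (Φ.toPerfPair.apply_symm_apply (extendInt b.flip w)) (Φ.coroot i)

/-- The weight `w / p` attached to a functional `w` on the coroot lattice. -/
lemma exists_mem_fracWeightLattice (b : Φ.Base) (w : Φ.flip.rootSpan ℤ →ₗ[ℤ] ℤ) {p m : ℕ}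
    (hm : m ≠ 0) (hpm : p ∣ m) :
    ∃ lam ∈ fracWeightLattice Φ m,
      integralRoots Φ lam = {i | (p : ℤ) ∣ w (Φ.flip.rootSpanMem ℤ i)} := by
  obtain ⟨e, rfl⟩ := hpm
  obtain ⟨mu, hmu⟩ := exists_weight_eq b w
  have hp : (p : ℂ) ≠ 0 := by
    rintro h
    simp_all
  have he : (e : ℂ) ≠ 0 := by
    rintro h
    simp_all
  -- With m = pe, the weight mu/p is written as (e mu)/m.
  refine ⟨((p * e : ℕ) : ℂ)⁻¹ • (e : ℂ) • mu, ⟨_, fun i ↦ ⟨e * w (Φ.flip.rootSpanMem ℤ i), ?_⟩, rfl⟩,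
    Set.ext fun i ↦ ?_⟩
  · rw [map_smul, hmu]
    simp
  · simp only [integralRoots, Set.mem_ofPred_eq, map_smul, hmu, smul_eq_mul, Nat.cast_mul, mul_inv]
    refine exists_congr fun n ↦ ?_
    field_simp
    rw [← Int.cast_natCast, ← Int.cast_mul, Int.cast_inj]

/-- A weight with values in the roots of unity. -/
lemma exists_weightRoots_eq_setOf_dvd {b : Φ.Base} {d : b.support → ℕ} (s : K) {p : ℕ} (hp : p ≠ 0)
    (u : Φ.rootSpan ℤ →ₗ[ℤ] ℤ) : ∃ Lam : Weight Φ (adjoinField s),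
      weightRoots b d (qElt s) Lam = {i | (p : ℤ) ∣ u (Φ.rootSpanMem ℤ i)} := by
  -- Order 2p rather than p offsets the factor 2 in K_{2α}, which matters for p = 2.
  obtain ⟨ζ, hζ⟩ := exists_isPrimitiveRoot s (mul_ne_zero two_ne_zero hp)
  have hζ0 : ζ ≠ 0 := hζ.ne_zero (mul_ne_zero two_ne_zero hp)
  obtain ⟨Lam, hLam⟩ := exists_weight hζ0 u
  refine ⟨Lam, Set.ext fun i ↦ ?_⟩
  have hdvd : ζ ^ (2 * u (Φ.rootSpanMem ℤ i)) = 1 ↔ (p : ℤ) ∣ u (Φ.rootSpanMem ℤ i) := by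
    rw [hζ.zpow_eq_one_iff_dvd, Nat.cast_mul, Nat.cast_ofNat, mul_dvd_mul_iff_left two_ne_zero]
  simp only [weightRoots, IsQPow, Set.mem_ofPred_eq, hLam, map_smul, smul_eq_mul, Nat.cast_one,
    one_mul, ← hdvd]
  constructor
  · rintro ⟨k, a, -, ha⟩
    have h1 : qElt s ^ (a * (2 * p : ℕ)) = 1 := by
      rw [zpow_mul, ← ha, ← zpow_mul, mul_comm, zpow_mul, zpow_natCast, hζ.pow_eq_one, one_zpow]
    have h2 := eq_zero_of_qElt_zpow_eq_one s h1
    obtain rfl : a = 0 := by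
      refine (mul_eq_zero.mp h2).resolve_right ?_
      exact_mod_cast mul_ne_zero two_ne_zero hp
    rw [ha, zpow_zero]
  · intro h
    exact ⟨0, 0, by simp, by rw [h, zpow_zero]⟩

variable [Finite ι] [Φ.IsCrystallographic] [Φ.IsReduced]

/-- With l the half-length of α, (λ, 2α) = 2l⟨λ, α^∨⟩ and (α, α) = 2l; as q is not a root of unity,
the exponents can be compared and 2l cancelled. -/
theorem exists_isLinearWeight {b : Φ.Base} {d : b.support → ℕ} (hd : IsSymmetrizer b d) {m : ℕ}
    (hm : m ≠ 0) {lam : V} (hlam : lam ∈ fracWeightLattice Φ m) {s : K} (hs : s ^ m = qK) :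
    ∃ Lam : Weight Φ (adjoinField s),
      IsLinearWeight b d (IntermediateField.AdjoinSimple.gen (RatFunc ℂ) s) m lam Lam ∧
      weightRoots b d (qElt s) Lam = integralRoots Φ lam := by
  obtain ⟨mu, hmu, rfl⟩ := hlam
  choose n hn using hmu
  set lam := (m : ℂ)⁻¹ • mu with hlam
  have hm' : (m : ℂ) ≠ 0 := by exact_mod_cast hm
  have hlam' (i : ι) : (m : ℂ) * Φ.coroot' i lam = n i := by
    rw [hlam, map_smul, hn, smul_eq_mul, mul_inv_cancel_left₀ hm']
  set t := IntermediateField.AdjoinSimple.gen (RatFunc ℂ) s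
  have htq : t ^ m = qElt s := gen_pow_eq_qElt hs
  have ht : t ≠ 0 := by
    intro h
    rw [h, zero_pow hm] at htq
    exact qElt_ne_zero s htq.symm
  let c : Φ.rootSpan ℤ →ₗ[ℤ] ℤ := b.toWeightBasisInt.constr ℤ fun i ↦ d i * n i
  have hc (x : Φ.rootSpan ℤ) : (m : ℂ) * form b d lam x = c x := by
    suffices ((m : ℂ) • form b d lam).restrictScalars ℤ ∘ₗ (Φ.rootSpan ℤ).subtype =
        Algebra.linearMap ℤ ℂ ∘ₗ c by simpa using LinearMap.congr_fun this x
    refine b.toWeightBasisInt.ext fun i ↦ ?_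
    have h1 : c (b.toWeightBasisInt i) = d i * n i := by simp only [c, Basis.constr_basis]
    rw [LinearMap.comp_apply, LinearMap.comp_apply, h1]
    simp only [Submodule.subtype_apply, RootPairing.Base.coe_toWeightBasisInt_apply,
      LinearMap.coe_restrictScalars, LinearMap.smul_apply, form_root_right hd, halfLength_simple hd,
      smul_eq_mul, Algebra.linearMap_apply, eq_intCast, Int.cast_mul, Int.cast_natCast]
    rw [← hlam']
    ring
  obtain ⟨Lam, hLam⟩ := exists_weight ht c
  refine ⟨Lam, fun μ ↦ ⟨c μ, hc μ, hLam μ⟩, Set.ext fun i ↦ exists_congr fun k ↦ ?_⟩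
  have hl : (halfLength hd i : ℂ) ≠ 0 := by exact_mod_cast (halfLength_pos hd i).ne'
  have hform : (k : ℂ) * form b d (Φ.root i) (Φ.root i) = ((k * (halfLength hd i * 2) : ℤ) : ℂ) := by
    rw [form_root_left hd, Φ.root_coroot'_eq_pairing, Φ.pairing_same]
    push_cast
    ring
  have hci : (c (Φ.rootSpanMem ℤ i) : ℂ) = m * (halfLength hd i * Φ.coroot' i lam) := by
    rw [← hc, ← form_root_right hd]
  have hpow (a : ℤ) : qElt s ^ a = t ^ ((m : ℤ) * a) := by
    rw [← htq, ← zpow_natCast, ← zpow_mul]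
  have hinj (a : ℤ) : t ^ (2 * c (Φ.rootSpanMem ℤ i)) = qElt s ^ a ↔
      2 * c (Φ.rootSpanMem ℤ i) = m * a := by
    refine ⟨fun h ↦ ?_, fun h ↦ by rw [hpow, h]⟩
    rw [hpow] at h
    have h1 : t ^ (2 * c (Φ.rootSpanMem ℤ i) - m * a) = 1 := by
      rw [zpow_sub₀ ht, h, div_self (zpow_ne_zero _ ht)]
    have h2 : qElt s ^ (2 * c (Φ.rootSpanMem ℤ i) - m * a) = 1 := by
      rw [hpow, mul_comm, zpow_mul, h1, one_zpow]
    exact sub_eq_zero.mp (eq_zero_of_qElt_zpow_eq_one s h2)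
  simp only [IsQPow, hform, hLam, map_smul, smul_eq_mul, Nat.cast_one, one_mul, Int.cast_inj,
    exists_eq_left', hinj]
  rw [← Int.cast_inj (α := ℂ)]
  push_cast
  rw [hci]
  constructor
  · intro h
    have : (2 * m * halfLength hd i : ℂ) * Φ.coroot' i lam = (2 * m * halfLength hd i : ℂ) * k := by
      linear_combination h
    exact mul_left_cancel₀ (by simp [hm', hl]) this
  · intro h
    rw [h]
    ring

end LinearWeights

/-! ### Sublattices and reduction modulo a prime -/

section Sublattices

/-- A proper sublattice of the root lattice is annihilated by a functional modulo a prime. -/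
lemma exists_prime_functional_of_ne_top [Finite ι] (b : Φ.Base) {N : Submodule ℤ (Φ.rootSpan ℤ)} (hN : N ≠ ⊤) :
    ∃ p : ℕ, p.Prime ∧ ∃ u : Φ.rootSpan ℤ →ₗ[ℤ] ℤ,
      (∀ x ∈ N, (p : ℤ) ∣ u x) ∧ ∃ x, ¬ (p : ℤ) ∣ u x :=
  have : Module.Free ℤ (Φ.rootSpan ℤ) := .of_basis b.toWeightBasisInt
  exists_prime_functional hN

lemma root_mem_span_of_span_rootSpanMem_eq_top {Ψ : Set ι}
    (h : span ℤ (Φ.rootSpanMem ℤ '' Ψ) = ⊤) (i : ι) : Φ.root i ∈ span ℤ (Φ.root '' Ψ) := by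
  have h1 : Φ.rootSpanMem ℤ i ∈ span ℤ (Φ.rootSpanMem ℤ '' Ψ) := h ▸ Submodule.mem_top
  have h2 := Submodule.mem_map_of_mem (f := (Φ.rootSpan ℤ).subtype) h1
  rw [Submodule.map_span, ← Set.image_comp] at h2
  exact h2

/-- A sublattice which surjects onto the root lattice modulo a prime has full rank. -/
lemma span_root_eq_top_of_sup_eq_top [Finite ι] [Φ.IsRootSystem] {Ψ : Set ι} {p : ℕ} (hp : p.Prime)
    (h : span ℤ (Φ.rootSpanMem ℤ '' Ψ) ⊔
      LinearMap.range (LinearMap.lsmul ℤ (Φ.rootSpan ℤ) (p : ℤ)) = ⊤) :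
    span ℂ (Φ.root '' Ψ) = ⊤ := by
  set L := span ℤ (Φ.rootSpanMem ℤ '' Ψ) with hL
  -- Nakayama: Q/L equals p(Q/L), so some r ≡ 1 mod p, in particular nonzero, kills it.
  obtain ⟨r, hr, hr0⟩ := Submodule.exists_sub_one_mem_and_smul_eq_zero_of_fg_of_le_smul
    (Ideal.span {(p : ℤ)}) (⊤ : Submodule ℤ (Φ.rootSpan ℤ ⧸ L)) Module.Finite.fg_top (by
      rintro y -
      obtain ⟨x, rfl⟩ := L.mkQ_surjective y
      have hx : x ∈ L ⊔ LinearMap.range (LinearMap.lsmul ℤ (Φ.rootSpan ℤ) (p : ℤ)) :=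
        h ▸ Submodule.mem_top
      obtain ⟨l, hl, -, ⟨z, rfl⟩, rfl⟩ := Submodule.mem_sup.mp hx
      have : L.mkQ l = 0 := by simpa using hl
      rw [map_add, this, zero_add, LinearMap.lsmul_apply, map_smul]
      exact Submodule.smul_mem_smul (Ideal.mem_span_singleton_self _) Submodule.mem_top)
  have hr' : r ≠ 0 := by
    rintro rfl
    rw [zero_sub, Ideal.neg_mem_iff, Ideal.mem_span_singleton] at hr
    exact hp.one_lt.ne' (Nat.dvd_one.mp (by exact_mod_cast hr))
  rw [eq_top_iff, ← RootPairing.IsRootSystem.span_root_eq_top (P := Φ), Submodule.span_le]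
  rintro - ⟨i, rfl⟩
  have h1 : r • Φ.rootSpanMem ℤ i ∈ L := by
    rw [← Submodule.Quotient.mk_eq_zero, Submodule.Quotient.mk_smul]
    exact hr0 _ Submodule.mem_top
  have h2 := Submodule.mem_map_of_mem (f := (Φ.rootSpan ℤ).subtype) h1
  rw [hL, Submodule.map_span, ← Set.image_comp] at h2
  have h3 : (r : ℂ) • Φ.root i ∈ span ℂ (Φ.root '' Ψ) := by
    rw [Int.cast_smul_eq_zsmul]
    exact Submodule.span_le_restrictScalars ℤ ℂ _ h2
  exact ((span ℂ (Φ.root '' Ψ)).smul_mem_iff (by exact_mod_cast hr')).mp h3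

end Sublattices

end

end QRoot

/-! ### The theorem -/

open QRoot in
theorem proposition5p8
    {ι V V' : Type*} [Finite ι] [AddCommGroup V] [Module ℂ V] [AddCommGroup V'] [Module ℂ V']
    (Φ : RootPairing ι ℂ V V') [Φ.IsRootSystem] [Φ.IsCrystallographic] [Φ.IsReduced]
    [Φ.IsIrreducible]
    (b : Φ.Base) (d : b.support → ℕ) (hd : QRoot.IsSymmetrizer b d)
    (θ : ι) (hθ : QRoot.IsHighestRoot b θ)
    (Ψ : Set ι) (hΨ : QRoot.IsMaximalSubsystem Φ Ψ) :
    (∀ s : QRoot.K, s ^ QRoot.gammaConst b θ = QRoot.qK →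
      ∃ Lam : QRoot.Weight Φ (QRoot.adjoinField s),
        Ψ = QRoot.weightRoots b d (QRoot.qElt s) Lam) ∧
    (QRoot.IsDualClosed Φ Ψ →
      ∀ m : ℕ, 2 ≤ m → QRoot.gammaConst b θ ∣ m →
        ∃ lam ∈ QRoot.fracWeightLattice Φ m,
          Ψ = QRoot.integralRoots Φ lam ∧
          ∀ s : QRoot.K, s ^ m = QRoot.qK →
            ∃ Lam : QRoot.Weight Φ (QRoot.adjoinField s),
              QRoot.IsLinearWeight b d (IntermediateField.AdjoinSimple.gen (RatFunc ℂ) s) m lam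
                Lam ∧
              Ψ = QRoot.weightRoots b d (QRoot.qElt s) Lam) := by
  have hdual {p : ℕ} {w : Φ.flip.rootSpan ℤ →ₗ[ℤ] ℤ}
      (hw : ∀ x ∈ span ℤ (Φ.flip.rootSpanMem ℤ '' Ψ), (p : ℤ) ∣ w x) (hne : ∃ x, ¬ (p : ℤ) ∣ w x) :
      Ψ = {i | (p : ℤ) ∣ w (Φ.flip.rootSpanMem ℤ i)} :=
    hΨ.flip.eq_setOf_dvd (fun i hi ↦ hw _ (subset_span (Set.mem_image_of_mem _ hi))) hne
  have hgamma {p : ℕ} (hp : p.Prime) {w : Φ.flip.rootSpan ℤ →ₗ[ℤ] ℤ}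
      (hw : Ψ = {i | (p : ℤ) ∣ w (Φ.flip.rootSpanMem ℤ i)}) (hspan : span ℂ (Φ.root '' Ψ) = ⊤) :
      p ∣ gammaConst b θ := by
    refine dvd_gammaConst hd hθ hp (w := w) (hw ▸ hspan) ?_
    by_contra! hall
    exact hΨ.2.1 (hw ▸ Set.eq_univ_of_forall hall)
  constructor
  · intro s hs
    by_cases hQ : span ℤ (Φ.rootSpanMem ℤ '' Ψ) = ⊤
    · have hroot := root_mem_span_of_span_rootSpanMem_eq_top hQ
      have hQ' : span ℤ (Φ.flip.rootSpanMem ℤ '' Ψ) ≠ ⊤ := fun h ↦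
        hΨ.2.1 (hΨ.1.eq_univ_of_span_eq hroot (root_mem_span_of_span_rootSpanMem_eq_top (Φ := Φ.flip) h))
      obtain ⟨p, hp, w, hw, hne⟩ := exists_prime_functional_of_ne_top b.flip hQ'
      have hΨw := hdual hw hne
      have hspan : span ℂ (Φ.root '' Ψ) = ⊤ := by
        rw [eq_top_iff, ← RootPairing.IsRootSystem.span_root_eq_top (P := Φ), Submodule.span_le]
        rintro - ⟨i, rfl⟩
        exact Submodule.span_le_restrictScalars ℤ ℂ _ (hroot i)
      have hγ := gammaConst_ne_zero b θ
      obtain ⟨lam, hlam, hint⟩ := exists_mem_fracWeightLattice b w hγ (hgamma hp hΨw hspan)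
      obtain ⟨Lam, -, hLam⟩ := exists_isLinearWeight hd hγ hlam hs
      exact ⟨Lam, by rw [hLam, hint, ← hΨw]⟩
    · obtain ⟨p, hp, u, hu, hne⟩ := exists_prime_functional_of_ne_top b hQ
      obtain ⟨Lam, hLam⟩ := exists_weightRoots_eq_setOf_dvd (b := b) (d := d) s hp.ne_zero u
      refine ⟨Lam, hLam ▸ hΨ.eq_setOf_dvd (fun i hi ↦ ?_) hne⟩
      exact hu _ (subset_span (Set.mem_image_of_mem _ hi))
  · intro hcl m hm hγm
    obtain ⟨p, hpm, w, hw⟩ : ∃ p, p ∣ m ∧ ∃ w : Φ.flip.rootSpan ℤ →ₗ[ℤ] ℤ,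
        Ψ = {i | (p : ℤ) ∣ w (Φ.flip.rootSpanMem ℤ i)} := by
      -- Any prime factor of m would serve; m ≥ 2 provides one even when γ = 1.
      have hmin : m.minFac.Prime := Nat.minFac_prime (by lia)
      by_cases hsup : span ℤ (Φ.flip.rootSpanMem ℤ '' Ψ) ⊔
          LinearMap.range (LinearMap.lsmul ℤ (Φ.flip.rootSpan ℤ) (m.minFac : ℤ)) = ⊤
      · have hspan := span_root_eq_top_of_span_coroot hd (span_root_eq_top_of_sup_eq_top (Φ := Φ.flip) hmin hsup)
        have hQ' : span ℤ (Φ.flip.rootSpanMem ℤ '' Ψ) ≠ ⊤ := fun h ↦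
          hΨ.2.1 (Set.eq_univ_of_forall fun i ↦ hcl.mem_of_root_mem_span hΨ.1.flip
            (root_mem_span_of_span_rootSpanMem_eq_top (Φ := Φ.flip) h i))
        obtain ⟨p, hp, w, hw, hne⟩ := exists_prime_functional_of_ne_top b.flip hQ'
        have hΨw := hdual hw hne
        exact ⟨p, (hgamma hp hΨw hspan).trans hγm, w, hΨw⟩
      · obtain ⟨p, hp, w, hw, x, hx⟩ := exists_prime_functional_of_ne_top b.flip hsup
        -- The functional is divisible by p on `m.minFac` times the lattice but not on the lattice
        -- itself, so p is that prime.
        obtain rfl : p = m.minFac := by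
          have h1 := hw _ (Submodule.mem_sup_right ⟨x, rfl⟩)
          rw [LinearMap.lsmul_apply, map_smul, smul_eq_mul] at h1
          have h2 := ((Nat.prime_iff_prime_int.mp hp).dvd_or_dvd h1).resolve_right hx
          exact (Nat.prime_dvd_prime_iff_eq hp hmin).mp (Int.natCast_dvd_natCast.mp h2)
        exact ⟨_, m.minFac_dvd, w, hdual (fun x hx ↦ hw x (Submodule.mem_sup_left hx)) ⟨x, hx⟩⟩
    have hm0 : m ≠ 0 := by lia
    obtain ⟨lam, hlam, hint⟩ := exists_mem_fracWeightLattice b w hm0 hpm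
    refine ⟨lam, hlam, by rw [hint, ← hw], fun s hs ↦ ?_⟩
    obtain ⟨Lam, hlin, hLam⟩ := exists_isLinearWeight hd hm0 hlam hs
    exact ⟨Lam, hlin, by rw [hLam, hint, ← hw]⟩
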